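/- Let $\mathbb B_n$ be the closed unit ball of $\mathbb R^n$ and $V_n$ the $n$-dimensional Lebesgue measure. For positive integers $n,m$ let $$V(n,m)=\frac{1}{V_n(\mathbb B_n)}\max_{z_1,\dots,z_m\in\mathbb B_n}V_n\big(\mathrm{conv}\{z_1,\dots,z_m\}\big).$$ (i) For every real $c$ with $1<c\le 1.05$ there is a real constant $N(c)$ such that $$V(n,\lfloor c^n\rfloor)<\big(3\sqrt{\log c}\,\big)^n\qquad\text{for all positive integers } n>N(c).\tag{1}$$ (ii) Let $M,n$ be positive integers, let $A>0$, $B\in(0,1)$, $C>0$, and let $x_1,\dots,x_M$ be random points in $\mathbb R^n$ (not necessarily independent or identically distributed) whose joint distribution satisfies the SmAC condition with constants $A,B,C$: for every index $i$, for almost all values $(y_j)_{j\ne i}$ of the other points $(x_j)_{j\neq i}$, and for every convex Borel set $S\subset\mathbb R^n$ with $V_n(S)/V_n(\mathbb B_n)\le A^n$, $$\mathbb P\big(x_i\in\mathbb B_n\setminus S\;\big|\;x_j=y_j\ \forall j\ne i\big)\ge 1-CB^n,$$ where the conditional probability is the regular conditional distribution. Put $$b=\min\{1.05,\;1/B,\;\exp((A/3)^2)\},$$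 so that $1<b\le 1.05$, let $N(b)$ be any real constant for which (1) holds with $c=b$, let $\delta>0$, and put $$a=\min\{1,\;\delta/(2C),\;b^{-N(b)}\}.$$ If $M\le a\,b^n$, then with probability greater than $1-\delta$ the set $F=\{x_1,\dots,x_M\}$ is linearly separable, that is, for each $x\in F$ there is a linear functional $l$ with $l(x)>l(y)$ for all $y\in F$, $y\ne x$ (equivalently, each $x\in F$ is a vertex of the convex hull of $F$). -/

import Mathlib

open MeasureTheory ProbabilityTheory

/-- A finite set `F` is linearly separable if every point of `F` is strictly separated from the
other points of `F` by a linear functional. -/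
def LinearlySeparable {n : ℕ} (F : Set (EuclideanSpace ℝ (Fin n))) : Prop :=
  ∀ x ∈ F, ∃ l : EuclideanSpace ℝ (Fin n) →ₗ[ℝ] ℝ, ∀ y ∈ F, y ≠ x → l y < l x

/-- The equivalent description of linear separability: every point of the finite set `F` is an
extreme point (vertex) of the convex hull of `F`. -/
theorem linearlySeparable_iff_extremePoints {n : ℕ} {F : Set (EuclideanSpace ℝ (Fin n))}
    (hF : F.Finite) :
    LinearlySeparable F ↔ ∀ x ∈ F, x ∈ (convexHull ℝ F).extremePoints ℝ := by
  constructor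
  · intro h x hx
    obtain ⟨l, hl⟩ := h x hx
    have key : ∀ a ∈ convexHull ℝ F, a ≠ x → l a < l x := by
      intro a ha hax
      rcases (F \ {x}).eq_empty_or_nonempty with he | hne
      · have : F ⊆ {x} := Set.sdiff_eq_empty.mp he
        have h2 := convexHull_mono (𝕜 := ℝ) this ha
        rw [convexHull_singleton] at h2
        exact absurd h2 hax
      · rw [← Set.insert_sdiff_self_of_mem hx, convexHull_insert hne, mem_convexJoin] at ha
        obtain ⟨p, hp, q, hq, hs⟩ := ha
        rw [Set.mem_singleton_iff] at hp
        subst hp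
        have hq' : l q < l p := by
          have hc : Convex ℝ {z | l z < l p} := convex_halfSpace_lt l.isLinear _
          exact convexHull_min (fun y hy => hl y hy.1 hy.2) hc hq
        obtain ⟨s, t, hs0, ht0, hst, rfl⟩ := hs
        have ht : 0 < t := by
          rcases ht0.lt_or_eq with h | h
          · exact h
          · subst h
            have : s = 1 := by linarith
            subst this
            simp at hax
        simp only [map_add, map_smul, smul_eq_mul]
        have : s = 1 - t := by linarith
        subst this
        nlinarith
    rw [(convex_convexHull ℝ F).mem_extremePoints_iff_mem_sdiff_convexHull_sdiff]
    refine ⟨subset_convexHull ℝ F hx, fun hmem => ?_⟩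
    have hc : Convex ℝ {z | l z < l x} := convex_halfSpace_lt l.isLinear _
    exact lt_irrefl (l x) (convexHull_min (t := {z | l z < l x})
      (fun y hy => key y hy.1 hy.2) hc hmem)
  · intro h x hx
    have hxe := h x hx
    rw [(convex_convexHull ℝ F).mem_extremePoints_iff_mem_sdiff_convexHull_sdiff] at hxe
    have hnot : x ∉ convexHull ℝ (F \ {x}) := fun hm =>
      hxe.2 (convexHull_mono (Set.sdiff_subset_sdiff_left (subset_convexHull ℝ F)) hm)
    obtain ⟨f, u, hfu, hu⟩ := geometric_hahn_banach_closed_point (convex_convexHull ℝ (F \ {x}))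
      ((hF.subset Set.sdiff_subset).isClosed_convexHull ℝ) hnot
    exact ⟨f.toLinearMap, fun y hy hyx =>
      (hfu y (subset_convexHull ℝ _ ⟨hy, hyx⟩)).trans hu⟩

/-- The SmAC (smeared absolute continuity) condition with constants `A`, `B`, `C` for random points
`X 0, …, X (M - 1)` of `ℝⁿ`: conditionally on the values `y j` of the other points, `X i` lies in
the unit ball and outside `S` with probability at least `1 - C * B ^ n`, for every convex set `S`
whose volume relative to the unit ball is at most `A ^ n`. The conditional probability is the
regular conditional distribution, which is determined for almost every `y`. -/
structure SmACWith {Ω : Type*} [MeasurableSpace Ω] (P : Measure Ω) [IsProbabilityMeasure P]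
    {M n : ℕ} (A B C : ℝ) (X : Fin M → Ω → EuclideanSpace ℝ (Fin n)) : Prop where
  A_pos : 0 < A
  B_pos : 0 < B
  B_lt_one : B < 1
  C_pos : 0 < C
  cond : ∀ i : Fin M,
    ∀ᵐ y ∂(P.map (fun (ω : Ω) (j : {j : Fin M // j ≠ i}) => X j ω)),
      ∀ S : Set (EuclideanSpace ℝ (Fin n)), Convex ℝ S → MeasurableSet S →
        volume S / volume (Metric.closedBall (0 : EuclideanSpace ℝ (Fin n)) 1)
          ≤ ENNReal.ofReal (A ^ n) →
        1 - C * B ^ n ≤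
          (condDistrib (X i) (fun (ω : Ω) (j : {j : Fin M // j ≠ i}) => X j ω) P y).real
            (Metric.closedBall 0 1 \ S)

/-- `V(n, m)`: the largest volume, relative to the unit ball of `ℝⁿ`, of the convex hull of `m`
points of the unit ball. -/
noncomputable def maxHullVolume (n m : ℕ) : ENNReal :=
  ⨆ (x : Fin m → EuclideanSpace ℝ (Fin n)) (_ : ∀ i, x i ∈ Metric.closedBall 0 1),
    volume (convexHull ℝ (Set.range x)) /
      volume (Metric.closedBall (0 : EuclideanSpace ℝ (Fin n)) 1)

/-- `N` is an admissible value of the constant `N(c)`: for every dimension `n > N`, one has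
`V(n, cⁿ) < (3 √(log c))ⁿ`, where the number of points `cⁿ` is rounded down. -/
def IsVolumeThreshold (c N : ℝ) : Prop :=
  ∀ n : ℕ, 0 < n → N < n →
    maxHullVolume n ⌊c ^ n⌋₊ < ENNReal.ofReal ((3 * √(Real.log c)) ^ n)

/-- The base `b = min {1.05, 1/B, exp((A/3)²)}` of the admissible number of points. -/
noncomputable def sepBase (A B : ℝ) : ℝ :=
  min (105 / 100) (min (1 / B) (Real.exp ((A / 3) ^ 2)))

/-- The factor `a = min {1, δ/(2C), b^(-N)}` of the admissible number of points. -/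
noncomputable def sepFactor (b C N δ : ℝ) : ℝ :=
  min 1 (min (δ / (2 * C)) (b ^ (-N)))

/-! Volume bound: by Maurey's argument the hull of `m` points of the unit ball is covered by `m ^ k`
balls of radius `1 / √k`, so its relative volume is at most `m ^ k / √k ^ n`. For `m ≤ c ^ n` this
is `(c ^ k / √k) ^ n`. The real minimiser `k = 1 / (2 log c)` gives base `√(2e log c) ≈ 2.33 √(log
c)`, and the slack up to `3` absorbs rounding `k`, in every dimension.

Separation: if the other points lie in the ball, their hull has relative volume at most `A ^ n`, so
SmAC bounds by `C * B ^ n` the conditional probability that `x_i` leaves the ball or falls in that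
hull. A union bound over `i` costs at most `M * C * B ^ n ≤ δ / 2`. Off these events each point
avoids the hull of the others, and Hahn–Banach separates it. -/

section ApproximateCaratheodory

variable {E : Type*} [NormedAddCommGroup E] [InnerProductSpace ℝ E]

/-- A point of a convex hull is not strictly below all generators in the direction `u`. -/
theorem exists_inner_le_of_mem_convexHull {s : Set E} {x : E} (hx : x ∈ convexHull ℝ s) (u : E) :
    ∃ z ∈ s, inner ℝ u z ≤ inner ℝ u x := by
  by_contra! h
  have hc : Convex ℝ {z | inner ℝ u x < inner ℝ u z} :=
    convex_halfSpace_gt (innerₛₗ ℝ u).isLinear _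
  exact lt_irrefl (inner ℝ u x) (convexHull_min (fun z hz => h z hz) hc hx)

/-- Maurey's lemma: a point `x` of the convex hull of points of the unit ball is approximated by
an average of `k` of these points up to an error `1 / √k`. -/
theorem exists_norm_sum_sub_sq_le {ι : Type*} {z : ι → E} (hz : ∀ i, ‖z i‖ ≤ 1) {x : E}
    (hx : x ∈ convexHull ℝ (Set.range z)) (k : ℕ) :
    ∃ f : Fin k → ι, ‖∑ j, z (f j) - (k : ℝ) • x‖ ^ 2 ≤ k := by
  induction k with
  | zero => exact ⟨Fin.elim0, by simp⟩
  | succ k ih =>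
    obtain ⟨f, hf⟩ := ih
    set v := ∑ j, z (f j) - (k : ℝ) • x with hv
    -- Greedy choice. The direction is `v - x`, not `v`, because `‖v + (z i - x)‖² = ‖v‖² + ‖z i‖² +
    -- 2⟪v - x, z i - x⟫ - ‖x‖²`, so the error grows by at most `1`.
    obtain ⟨_, ⟨i, rfl⟩, hi⟩ := exists_inner_le_of_mem_convexHull hx (v - x)
    refine ⟨Fin.cons i f, ?_⟩
    have hsum : ∑ j, z ((Fin.cons i f : Fin (k + 1) → ι) j) - ((k + 1 : ℕ) : ℝ) • x
        = v + (z i - x) := by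
      rw [Fin.sum_univ_succ, hv]
      simp only [Fin.cons_zero, Fin.cons_succ, Nat.cast_add, Nat.cast_one, add_smul, one_smul]
      abel
    rw [hsum, norm_add_sq_real, norm_sub_sq_real (z i) x]
    simp only [inner_sub_left, inner_sub_right, real_inner_self_eq_norm_sq] at hi ⊢
    have h1 : ‖z i‖ ^ 2 ≤ 1 := by
      have := hz i
      have := norm_nonneg (z i)
      nlinarith
    have h2 : inner ℝ (z i) x = inner ℝ x (z i) := real_inner_comm _ _
    push_cast
    nlinarith [sq_nonneg ‖x‖]

theorem convexHull_range_subset_iUnion_closedBall {ι : Type*} {z : ι → E} (hz : ∀ i, ‖z i‖ ≤ 1)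
    {k : ℕ} (hk : 0 < k) :
    convexHull ℝ (Set.range z) ⊆
      ⋃ f : Fin k → ι, Metric.closedBall ((k : ℝ)⁻¹ • ∑ j, z (f j)) (√k)⁻¹ := by
  intro x hx
  obtain ⟨f, hf⟩ := exists_norm_sum_sub_sq_le hz hx k
  refine Set.mem_iUnion.2 ⟨f, ?_⟩
  have hk' : (0 : ℝ) < k := by exact_mod_cast hk
  rw [Metric.mem_closedBall, dist_comm, dist_eq_norm]
  have h1 : (k : ℝ)⁻¹ • ∑ j, z (f j) - x = (k : ℝ)⁻¹ • (∑ j, z (f j) - (k : ℝ) • x) := by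
    rw [smul_sub, smul_smul, inv_mul_cancel₀ hk'.ne', one_smul]
  rw [h1, norm_smul, norm_inv, Real.norm_natCast]
  have h2 : ‖∑ j, z (f j) - (k : ℝ) • x‖ ≤ √k := Real.le_sqrt_of_sq_le hf
  calc (k : ℝ)⁻¹ * ‖∑ j, z (f j) - (k : ℝ) • x‖ ≤ (k : ℝ)⁻¹ * √k := by gcongr
    _ = (√k)⁻¹ := by
      rw [inv_mul_eq_div, Real.sqrt_div_self', one_div]

end ApproximateCaratheodory

/-! ### Volume of hulls of few points -/

theorem maxHullVolume_le (n m : ℕ) {k : ℕ} (hk : 0 < k) :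
    maxHullVolume n m ≤ ENNReal.ofReal ((m : ℝ) ^ k * (√k)⁻¹ ^ n) := by
  refine iSup₂_le fun x hx => ?_
  refine ENNReal.div_le_of_le_mul ?_
  calc volume (convexHull ℝ (Set.range x))
      ≤ volume (⋃ f : Fin k → Fin m,
          Metric.closedBall ((k : ℝ)⁻¹ • ∑ j, x (f j)) (√k)⁻¹) :=
        measure_mono (convexHull_range_subset_iUnion_closedBall
          (fun i => by simpa using hx i) hk)
    _ ≤ ∑ f : Fin k → Fin m,
          volume (Metric.closedBall ((k : ℝ)⁻¹ • ∑ j, x (f j)) (√k)⁻¹) := measure_iUnion_fintype_le _ _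
    _ = ∑ _f : Fin k → Fin m, ENNReal.ofReal ((√k)⁻¹ ^ n) *
          volume (Metric.closedBall (0 : EuclideanSpace ℝ (Fin n)) 1) := by
        refine Finset.sum_congr rfl fun f _ => ?_
        rw [Measure.addHaar_closedBall' _ _ (by positivity), finrank_euclideanSpace_fin]
    _ = ENNReal.ofReal ((m : ℝ) ^ k * (√k)⁻¹ ^ n) *
          volume (Metric.closedBall (0 : EuclideanSpace ℝ (Fin n)) 1) := by
        rw [Finset.sum_const, Finset.card_univ, Fintype.card_fun, Fintype.card_fin,
          Fintype.card_fin, nsmul_eq_mul, ENNReal.ofReal_mul (by positivity), mul_assoc,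
          ← Nat.cast_pow, ENNReal.ofReal_natCast]

/-- The number of points `k ≈ 1 / (2 log c)` in the averages makes the covering efficient. -/
theorem exists_pow_mul_inv_sqrt_lt {c : ℝ} (hc : 1 < c) (hc' : c ≤ 105 / 100) :
    ∃ k : ℕ, 0 < k ∧ c ^ k * (√k)⁻¹ < 3 * √(Real.log c) := by
  set t := Real.log c with ht
  have ht0 : 0 < t := Real.log_pos hc
  have ht1 : t ≤ 1 / 20 := by
    have := Real.log_le_sub_one_of_pos (zero_lt_one.trans hc)
    linarith
  refine ⟨⌈1 / (2 * t)⌉₊, Nat.ceil_pos.2 (by positivity), ?_⟩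
  set k := ⌈1 / (2 * t)⌉₊
  have hk : 1 / (2 * t) ≤ k := Nat.le_ceil _
  have hk2 : (k : ℝ) < 1 / (2 * t) + 1 := Nat.ceil_lt_add_one (by positivity)
  have hk0 : (0 : ℝ) < k := lt_of_lt_of_le (by positivity) hk
  have ht2 : 1 / (2 * t) * t = 1 / 2 := by field_simp
  -- Since `k * t` lies in `[1/2, 11/20]`, `exp (k * t) < 2 ≤ 3 * √(k * t)`, using `11/20 < log 2`
  -- and `4/9 ≤ 1/2`.
  have hs1 : 1 / 2 ≤ k * t := by nlinarith
  have hs2 : k * t ≤ 11 / 20 := by nlinarith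
  have hck : c ^ k = Real.exp (k * t) := by
    rw [Real.exp_nat_mul, ht, Real.exp_log (by linarith)]
  have hexp : Real.exp (k * t) < 2 := by
    rw [← Real.lt_log_iff_exp_lt two_pos]
    linarith [Real.log_two_gt_d9]
  rw [← div_eq_mul_inv, div_lt_iff₀ (by positivity), mul_assoc, ← Real.sqrt_mul ht0.le, hck]
  have h3 : (2 / 3 : ℝ) ≤ √(t * k) := Real.le_sqrt_of_sq_le (by linarith)
  linarith

/-- The choice of `k` depends on `c` only, so the bound on the base is raised to the power `n` and
no large dimension is needed. -/
theorem isVolumeThreshold_zero {c : ℝ} (hc : 1 < c) (hc' : c ≤ 105 / 100) :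
    IsVolumeThreshold c 0 := by
  intro n hn _
  obtain ⟨k, hk, hlt⟩ := exists_pow_mul_inv_sqrt_lt hc hc'
  refine (maxHullVolume_le n _ hk).trans_lt ((ENNReal.ofReal_lt_ofReal_iff_of_nonneg
    (by positivity)).2 ?_)
  calc (⌊c ^ n⌋₊ : ℝ) ^ k * (√k)⁻¹ ^ n ≤ (c ^ n) ^ k * (√k)⁻¹ ^ n := by
        gcongr
        exact Nat.floor_le (by positivity)
    _ = (c ^ k * (√k)⁻¹) ^ n := by rw [mul_pow, ← pow_mul, ← pow_mul, mul_comm n k]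
    _ < (3 * √(Real.log c)) ^ n := by
        gcongr

/-! ### Hulls of finite families: measurability and separation -/

theorem mem_convexHull_range_iff_stdSimplex {ι E : Type*} [Fintype ι] [AddCommGroup E] [Module ℝ E]
    {y : ι → E} {x : E} :
    x ∈ convexHull ℝ (Set.range y) ↔ ∃ w ∈ stdSimplex ℝ ι, ∑ i, w i • y i = x := by
  classical
  have h : Set.range y = Fintype.linearCombination ℝ y '' Set.range fun i => Pi.single i 1 := by
    rw [← Set.range_comp]
    congr 1
    ext i
    simp [Fintype.linearCombination_apply_single]
  rw [h, ← LinearMap.image_convexHull, convexHull_rangle_single_eq_stdSimplex]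
  simp [Fintype.linearCombination_apply]

/-- The relation that `x` lies in the convex hull of the points `y j` is closed. -/
theorem isClosed_setOf_mem_convexHull_range {ι E : Type*} [Fintype ι] [AddCommGroup E] [Module ℝ E]
    [TopologicalSpace E] [IsTopologicalAddGroup E] [ContinuousSMul ℝ E] [T2Space E] :
    IsClosed {p : (ι → E) × E | p.2 ∈ convexHull ℝ (Set.range p.1)} := by
  -- The weights are added as a coordinate. They range over a compact simplex, so forgetting them is
  -- a closed map.
  have hcl : IsClosed {q : stdSimplex ℝ ι × ((ι → E) × E) |
      ∑ i, (q.1 : ι → ℝ) i • q.2.1 i = q.2.2} := by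
    refine isClosed_eq ?_ (by fun_prop)
    refine continuous_finsetSum _ fun i _ => Continuous.smul ?_ (by fun_prop)
    exact (continuous_apply i).comp (continuous_subtype_val.comp continuous_fst)
  convert isClosedMap_snd_of_compactSpace _ hcl using 1
  ext ⟨y, x⟩
  simp only [Set.mem_ofPred_eq, Set.mem_image, Prod.exists, exists_eq_right, Subtype.exists,
    mem_convexHull_range_iff_stdSimplex]
  exact exists_congr fun _ => exists_prop.symm

theorem exists_hullVolume_le_maxHullVolume {n m : ℕ} {ι : Type*} [Fintype ι] [Nonempty ι]
    (hm : Fintype.card ι ≤ m) {y : ι → EuclideanSpace ℝ (Fin n)}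
    (hy : ∀ i, y i ∈ Metric.closedBall 0 1) :
    volume (convexHull ℝ (Set.range y)) /
      volume (Metric.closedBall (0 : EuclideanSpace ℝ (Fin n)) 1) ≤ maxHullVolume n m := by
  -- Points may be repeated to reach exactly `m`; this needs at least one point.
  obtain ⟨g, hg⟩ : ∃ g : Fin m → ι, Function.Surjective g := by
    obtain ⟨e⟩ := Function.Embedding.nonempty_of_card_le (α := ι) (β := Fin m) (by simpa using hm)
    exact ⟨Function.invFun e, Function.invFun_surjective e.injective⟩
  rw [← hg.range_comp y]
  exact le_iSup₂_of_le (y ∘ g) (fun i => hy (g i)) le_rfl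

theorem linearlySeparable_range {n : ℕ} {ι : Type*} [Finite ι] {x : ι → EuclideanSpace ℝ (Fin n)}
    (h : ∀ i, x i ∉ convexHull ℝ (Set.range fun j : {j // j ≠ i} => x j)) :
    LinearlySeparable (Set.range x) := by
  rintro _ ⟨i, rfl⟩
  obtain ⟨f, u, hfu, hu⟩ := geometric_hahn_banach_closed_point (convex_convexHull ℝ _)
    ((Set.finite_range fun j : {j // j ≠ i} => x j).isClosed_convexHull ℝ) (h i)
  refine ⟨f.toLinearMap, ?_⟩
  rintro _ ⟨j, rfl⟩ hj
  have hji : j ≠ i := fun h => hj (by rw [h])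
  exact (hfu _ (subset_convexHull ℝ _ ⟨⟨j, hji⟩, rfl⟩)).trans hu

/-- If almost every conditional distribution of `X` given `Y` charges the section of `s` with at
most `ε`, then so does the joint distribution. -/
theorem measure_preimage_le_of_condDistrib_le {Ω α β : Type*} [MeasurableSpace Ω]
    [MeasurableSpace α] [MeasurableSpace β] [StandardBorelSpace β] [Nonempty β]
    {P : Measure Ω} [IsProbabilityMeasure P] {Y : Ω → α} {X : Ω → β} (hY : Measurable Y)
    (hX : Measurable X) {s : Set (α × β)} (hs : MeasurableSet s) {ε : ENNReal}
    (h : ∀ᵐ y ∂(P.map Y), condDistrib X Y P y (Prod.mk y ⁻¹' s) ≤ ε) :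
    P {ω | (Y ω, X ω) ∈ s} ≤ ε := by
  have : IsProbabilityMeasure (P.map Y) := Measure.isProbabilityMeasure_map hY.aemeasurable
  calc P {ω | (Y ω, X ω) ∈ s} = P.map (fun ω => (Y ω, X ω)) s :=
        (Measure.map_apply (hY.prodMk hX) hs).symm
    _ = ∫⁻ y, condDistrib X Y P y (Prod.mk y ⁻¹' s) ∂(P.map Y) := by
        rw [← compProd_map_condDistrib hX.aemeasurable, Measure.compProd_apply hs]
    _ ≤ ∫⁻ _, ε ∂(P.map Y) := lintegral_mono_ae h
    _ = ε := by simp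

/-- The configurations in which the point `p.2` leaves the unit ball, or lies in the hull of the
points `p.1 j` while all of these are in the unit ball. -/
def badConfigurations (ι : Type*) (n : ℕ) :
    Set ((ι → EuclideanSpace ℝ (Fin n)) × EuclideanSpace ℝ (Fin n)) :=
  {p | p.2 ∈ Metric.closedBall 0 1 →
    (∀ j, p.1 j ∈ Metric.closedBall 0 1) ∧ p.2 ∈ convexHull ℝ (Set.range p.1)}

theorem measurableSet_badConfigurations (ι : Type*) [Fintype ι] (n : ℕ) :
    MeasurableSet (badConfigurations ι n) := by
  have h1 : MeasurableSet {p : (ι → EuclideanSpace ℝ (Fin n)) × EuclideanSpace ℝ (Fin n) |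
      p.2 ∈ Metric.closedBall 0 1} := measurable_snd Metric.isClosed_closedBall.measurableSet
  have h2 : MeasurableSet {p : (ι → EuclideanSpace ℝ (Fin n)) × EuclideanSpace ℝ (Fin n) |
      ∀ j, p.1 j ∈ Metric.closedBall 0 1} := by
    rw [Set.ofPred_forall]
    exact MeasurableSet.iInter fun j =>
      ((measurable_pi_apply j).comp measurable_fst) Metric.isClosed_closedBall.measurableSet
  exact h1.imp (h2.inter isClosed_setOf_mem_convexHull_range.measurableSet)

/-- The volume bound holds only when the `y j` lie in the ball. Otherwise the bad section is just
the complement of the ball, and SmAC is applied with `S = ∅`. -/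
theorem SmACWith.measure_bad_le {Ω : Type*} [MeasurableSpace Ω] {P : Measure Ω}
    [IsProbabilityMeasure P] {M n : ℕ} {X : Fin M → Ω → EuclideanSpace ℝ (Fin n)}
    (hX : ∀ i, Measurable (X i)) {A B C : ℝ} (h : SmACWith P A B C X) (i : Fin M)
    (hvol : ∀ y : {j : Fin M // j ≠ i} → EuclideanSpace ℝ (Fin n),
      (∀ j, y j ∈ Metric.closedBall 0 1) → volume (convexHull ℝ (Set.range y)) /
        volume (Metric.closedBall (0 : EuclideanSpace ℝ (Fin n)) 1) ≤ ENNReal.ofReal (A ^ n)) :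
    P {ω | ((fun j : {j : Fin M // j ≠ i} => X j ω), X i ω) ∈ badConfigurations _ n}
      ≤ ENNReal.ofReal (C * B ^ n) := by
  refine measure_preimage_le_of_condDistrib_le (P := P)
    (measurable_pi_lambda _ fun j : {j : Fin M // j ≠ i} => hX j) (hX i)
    (measurableSet_badConfigurations _ n) ?_
  filter_upwards [h.cond i] with y hy
  set κ := condDistrib (X i) (fun (ω : Ω) (j : {j : Fin M // j ≠ i}) => X j ω) P y
  have key : ∀ S : Set (EuclideanSpace ℝ (Fin n)), Convex ℝ S → MeasurableSet S →
      volume S / volume (Metric.closedBall (0 : EuclideanSpace ℝ (Fin n)) 1)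
        ≤ ENNReal.ofReal (A ^ n) →
      κ (Metric.closedBall 0 1 \ S)ᶜ ≤ ENNReal.ofReal (C * B ^ n) := by
    intro S hS hSm hSv
    have h1 := hy S hS hSm hSv
    have h2 : MeasurableSet (Metric.closedBall (0 : EuclideanSpace ℝ (Fin n)) 1 \ S) :=
      Metric.isClosed_closedBall.measurableSet.diff hSm
    rw [← ofReal_measureReal]
    refine ENNReal.ofReal_le_ofReal ?_
    rw [probReal_compl_eq_one_sub h2]
    linarith
  by_cases hball : ∀ j, y j ∈ Metric.closedBall (0 : EuclideanSpace ℝ (Fin n)) 1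
  · refine (measure_mono ?_).trans (key (convexHull ℝ (Set.range y)) (convex_convexHull ℝ _)
      ((Set.finite_range y).isClosed_convexHull ℝ).measurableSet (hvol y hball))
    intro x hx hx'
    exact hx'.2 (hx hx'.1).2
  · refine (measure_mono ?_).trans (key ∅ convex_empty MeasurableSet.empty (by simp))
    intro x hx hx'
    exact hball (hx hx'.1).1

/-! ### Choice of constants and the union bound -/

theorem one_lt_sepBase {A B : ℝ} (hA : 0 < A) (hB : 0 < B) (hB1 : B < 1) : 1 < sepBase A B :=
  lt_min (by norm_num) (lt_min (by rwa [lt_div_iff₀ hB, one_mul])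
    (Real.one_lt_exp_iff.2 (by positivity)))

theorem three_mul_sqrt_log_sepBase_le {A B : ℝ} (hA : 0 < A) (hB : 0 < B) (hB1 : B < 1) :
    3 * √(Real.log (sepBase A B)) ≤ A := by
  have h1 : Real.log (sepBase A B) ≤ (A / 3) ^ 2 := by
    rw [Real.log_le_iff_le_exp (zero_lt_one.trans (one_lt_sepBase hA hB hB1))]
    exact (min_le_right _ _).trans (min_le_right _ _)
  have h2 : √(Real.log (sepBase A B)) ≤ A / 3 := Real.sqrt_le_iff.2 ⟨by positivity, h1⟩
  linarith

theorem SmACWith.lt_measure_linearlySeparable {Ω : Type*} [MeasurableSpace Ω] {P : Measure Ω}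
    [IsProbabilityMeasure P] {M n : ℕ} (hn : 0 < n)
    {X : Fin M → Ω → EuclideanSpace ℝ (Fin n)} (hX : ∀ i, Measurable (X i)) {A B C : ℝ}
    (h : SmACWith P A B C X) {N : ℝ} (hN : IsVolumeThreshold (sepBase A B) N) {δ : ℝ} (hδ : 0 < δ)
    (hMle : (M : ℝ) ≤ sepFactor (sepBase A B) C N δ * sepBase A B ^ n) :
    1 - δ < P.real {ω | LinearlySeparable (Set.range fun i => X i ω)} := by
  have hA := h.A_pos
  have hB := h.B_pos
  have hC := h.C_pos
  have hb := one_lt_sepBase hA hB h.B_lt_one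
  have hb3 := three_mul_sqrt_log_sepBase_le hA hB h.B_lt_one
  have hbB : sepBase A B * B ≤ 1 := by
    rw [← le_div_iff₀ hB]
    exact (min_le_right _ _).trans (min_le_left _ _)
  set b := sepBase A B
  have hb0 : 0 < b := zero_lt_one.trans hb
  have hM1 : (M : ℝ) ≤ b ^ n := hMle.trans <|
    mul_le_of_le_one_left (by positivity) (min_le_left _ _)
  have hM2 : (M : ℝ) ≤ δ / (2 * C) * b ^ n := hMle.trans <| by
    gcongr
    exact (min_le_right _ _).trans (min_le_left _ _)
  have hM3 : (M : ℝ) ≤ b ^ ((n : ℝ) - N) := hMle.trans <| by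
    rw [sub_eq_neg_add, Real.rpow_add hb0, Real.rpow_natCast]
    gcongr
    exact (min_le_right _ _).trans (min_le_right _ _)
  -- For `M ≥ 2`, `1 < b ^ (n - N)` forces `n > N`. For `M = 1` this may fail, but there is nothing
  -- to separate.
  rcases Nat.lt_or_ge 1 M with hM' | hM'
  · have hnN : N < n := by
      have : 1 < b ^ ((n : ℝ) - N) := lt_of_lt_of_le (by exact_mod_cast hM') hM3
      rw [Real.one_lt_rpow_iff_of_pos hb0] at this
      rcases this with h1 | h1
      · linarith [h1.2]
      · linarith [h1.1]
    have hvol : ∀ (i : Fin M) (y : {j : Fin M // j ≠ i} → EuclideanSpace ℝ (Fin n)),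
        (∀ j, y j ∈ Metric.closedBall 0 1) → volume (convexHull ℝ (Set.range y)) /
          volume (Metric.closedBall (0 : EuclideanSpace ℝ (Fin n)) 1)
            ≤ ENNReal.ofReal (A ^ n) := by
      intro i y hy
      have : Nontrivial (Fin M) := Fin.nontrivial_iff_two_le.2 hM'
      have : Nonempty {j : Fin M // j ≠ i} := let ⟨j, hj⟩ := exists_ne i; ⟨⟨j, hj⟩⟩
      have hcard : Fintype.card {j : Fin M // j ≠ i} ≤ ⌊b ^ n⌋₊ :=
        (Fintype.card_subtype_le _).trans (by simpa using Nat.le_floor hM1)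
      refine (exists_hullVolume_le_maxHullVolume hcard hy).trans
        ((hN n hn hnN).le.trans (ENNReal.ofReal_le_ofReal ?_))
      gcongr
    set bad : Fin M → Set Ω := fun i =>
      {ω | ((fun j : {j : Fin M // j ≠ i} => X j ω), X i ω) ∈ badConfigurations _ n}
    have hmeas : MeasurableSet (⋃ i, bad i) := MeasurableSet.iUnion fun i =>
      ((measurable_pi_lambda _ fun j : {j : Fin M // j ≠ i} => hX j).prodMk (hX i))
        (measurableSet_badConfigurations _ n)
    have hbad : P.real (⋃ i, bad i) ≤ δ / 2 := by
      calc P.real (⋃ i, bad i) ≤ ∑ i, P.real (bad i) := measureReal_iUnion_fintype_le _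
        _ ≤ ∑ _i : Fin M, C * B ^ n := by
          refine Finset.sum_le_sum fun i _ => ?_
          exact ENNReal.toReal_le_of_le_ofReal (by positivity) (h.measure_bad_le hX i (hvol i))
        _ = M * (C * B ^ n) := by simp
        _ ≤ δ / (2 * C) * b ^ n * (C * B ^ n) := by gcongr
        _ = δ / 2 * (b * B) ^ n := by rw [mul_pow]; field_simp
        _ ≤ δ / 2 := mul_le_of_le_one_right (by positivity) (pow_le_one₀ (by positivity) hbB)
    -- The factor `2` in `δ / (2 * C)` makes this strict.
    calc 1 - δ < 1 - P.real (⋃ i, bad i) := by linarith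
      _ = P.real (⋃ i, bad i)ᶜ := (probReal_compl_eq_one_sub hmeas).symm
      _ ≤ _ := by
        refine measureReal_mono fun ω hω => linearlySeparable_range fun i hi => ?_
        have hgood : ∀ i, ω ∉ bad i := by simpa using hω
        -- Outside the ball the implication defining a bad configuration is vacuous, so good points
        -- all lie in the ball; only then does goodness exclude the hull.
        have hball : ∀ i, X i ω ∈ Metric.closedBall 0 1 := fun i => by
          by_contra hout
          exact hgood i fun hin => absurd hin hout
        exact hgood i fun _ => ⟨fun j => hball j, hi⟩
  · have hall : {ω | LinearlySeparable (Set.range fun i => X i ω)} = Set.univ := by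
      refine Set.eq_univ_of_forall fun ω => ?_
      have : Subsingleton (Fin M) := Fin.subsingleton_iff_le_one.2 hM'
      rintro _ ⟨i, rfl⟩
      refine ⟨0, ?_⟩
      rintro _ ⟨j, rfl⟩ hj
      exact absurd (by rw [Subsingleton.elim j i]) hj
    rw [hall, probReal_univ]
    linarith

theorem mainTheorem1 :
    (∀ c : ℝ, 1 < c → c ≤ 105 / 100 → ∃ N : ℝ, IsVolumeThreshold c N) ∧
    (∀ {Ω : Type*} [MeasurableSpace Ω] (P : Measure Ω) [IsProbabilityMeasure P]
      (M n : ℕ) (_ : 0 < M) (_ : 0 < n)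
      (X : Fin M → Ω → EuclideanSpace ℝ (Fin n)) (_ : ∀ i, Measurable (X i))
      (A B C : ℝ) (_ : SmACWith P A B C X)
      (N : ℝ) (_ : IsVolumeThreshold (sepBase A B) N)
      (δ : ℝ) (_ : 0 < δ)
      (_ : (M : ℝ) ≤ sepFactor (sepBase A B) C N δ * sepBase A B ^ n),
      1 - δ < P.real {ω | LinearlySeparable (Set.range fun i => X i ω)}) :=
  ⟨fun _ hc hc' => ⟨0, isVolumeThreshold_zero hc hc'⟩,
    fun _ _ _ _ _ hn _ hX _ _ _ h _ hN _ hδ hMle =>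
      h.lt_measure_linearlySeparable hn hX hN hδ hMle⟩
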